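/- Let $0<q<1$ and write $(x;q)_n=\prod_{k=0}^{n-1}(1-xq^k)$ for $n\in\{0,1,2,\dots\}\cup\{\infty\}$ and $(x_1,\dots,x_m;q)_n=\prod_{j=1}^m(x_j;q)_n$. Let $${}_{s+1}\phi_s\left({a_1,\dots,a_{s+1}\atop b_1,\dots,b_s};q,x\right)=\sum_{n=0}^\infty\frac{(a_1,\dots,a_{s+1};q)_n\,x^n}{(q,b_1,\dots,b_s;q)_n}$$ and let $${}_8W_7(a_1;a_4,\dots,a_8;q,x)={}_8\phi_7\left({a_1,\,q\sqrt{a_1},\,-q\sqrt{a_1},\,a_4,\dots,a_8\atop \sqrt{a_1},\,-\sqrt{a_1},\,qa_1/a_4,\dots,qa_1/a_8};q,x\right).$$ Let $a,b,c,d,r,z$ be complex numbers with $\max\{|a|,|b|,|c|,|d|,|r|\}<1$, $z\neq0$ and $|bcdrz|<1$, and suppose $a^2bcdr\neq q$ (so that no denominator in the ${}_8W_7$ series below vanishes). Then all the series below converge absolutely, and $$\sum_{n=0}^\infty\frac{(ab,ac,ad,ar;q)_n\,(bcdrz)^n}{(q,a^2bcdrz,abcd,abcr;q)_n}\;{}_3\phi_2\left({abq^n,\,acq^n,\,bc\atop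 abcdq^n,\,abcrq^n};q,dr\right) =\frac{(abdr,acdr;q)_\infty}{(dr,a^2bcdr;q)_\infty}\;{}_8W_7\left(\frac{a^2bcdr}{q};ab,ac,ad,ar,\frac1z;q,bcdrz\right).$$ (If some of $a,b,c,d,r$ vanish, the lower parameters $qa_1/a_j$ of the ${}_8W_7$ with $a_1=a^2bcdr/q$ and $a_j=ab,ac,ad,ar$ are read as $acdr,abdr,abcr,abcd$, and the factors $(q\sqrt{a_1},-q\sqrt{a_1};q)_n/(\sqrt{a_1},-\sqrt{a_1};q)_n$ are equal to $1$.) -/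

import Mathlib

/-- The finite `q`-shifted factorial `(a; q)_n = ∏_{k=0}^{n-1} (1 - a q^k)`. -/
noncomputable def qShift (q a : ℂ) (n : ℕ) : ℂ :=
  ∏ k ∈ Finset.range n, (1 - a * q ^ k)

/-- The infinite `q`-shifted factorial `(a; q)_∞ = ∏_{k=0}^∞ (1 - a q^k)`; the product converges
whenever `|q| < 1`. -/
noncomputable def qShiftInf (q a : ℂ) : ℂ :=
  ∏' k : ℕ, (1 - a * q ^ k)

/-- The multiple `q`-shifted factorial `(a₁, …, a_m; q)_n = (a₁; q)_n ⋯ (a_m; q)_n`. -/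
noncomputable def qShiftMul (q : ℂ) (as : List ℂ) (n : ℕ) : ℂ :=
  (as.map fun a => qShift q a n).prod

/-- The multiple infinite `q`-shifted factorial `(a₁, …, a_m; q)_∞`. -/
noncomputable def qShiftInfMul (q : ℂ) (as : List ℂ) : ℂ :=
  (as.map fun a => qShiftInf q a).prod

/-- The `n`-th term `(a₁, …, a_{r+1}; q)_n zⁿ / (q, b₁, …, b_r; q)_n` of the basic hypergeometric
series; `as` lists the `r + 1` upper and `bs` the `r` lower parameters. -/
noncomputable def phiTerm (as bs : List ℂ) (q z : ℂ) (n : ℕ) : ℂ :=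
  qShiftMul q as n * z ^ n / qShiftMul q (q :: bs) n

/-- The basic hypergeometric series `_{r+1}φ_r(a₁, …, a_{r+1}; b₁, …, b_r; q, z)`. -/
noncomputable def phi (as bs : List ℂ) (q z : ℂ) : ℂ :=
  ∑' n : ℕ, phiTerm as bs q z n

/-- Upper parameters `a₁, q√a₁, -q√a₁, a₄, …, a_{r+1}` of the very-well-poised series. The principal
square root is used; the series depends only on its square. -/
noncomputable def vwpUpper (a₁ : ℂ) (as : List ℂ) (q : ℂ) : List ℂ :=
  a₁ :: (q * a₁ ^ (1 / 2 : ℂ)) :: (-(q * a₁ ^ (1 / 2 : ℂ))) :: as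

/-- Lower parameters `√a₁, -√a₁, q a₁ / a₄, …, q a₁ / a_{r+1}` of the very-well-poised series. -/
noncomputable def vwpLower (a₁ : ℂ) (as : List ℂ) (q : ℂ) : List ℂ :=
  (a₁ ^ (1 / 2 : ℂ)) :: (-(a₁ ^ (1 / 2 : ℂ))) :: as.map fun x => q * a₁ / x

/-- The `n`-th term of the very-well-poised series `_{r+1}W_r(a₁; a₄, …, a_{r+1}; q, z)`. -/
noncomputable def vwpTerm (a₁ : ℂ) (as : List ℂ) (q z : ℂ) (n : ℕ) : ℂ :=
  phiTerm (vwpUpper a₁ as q) (vwpLower a₁ as q) q z n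

/-- The very-well-poised series `_{r+1}W_r(a₁; a₄, …, a_{r+1}; q, z)`. -/
noncomputable def vwp (a₁ : ℂ) (as : List ℂ) (q z : ℂ) : ℂ :=
  phi (vwpUpper a₁ as q) (vwpLower a₁ as q) q z

/-! Put P = a²bcdr and A = P/q. The proof reduces general z to z = 1 and evaluates z = 1 by two
classical summations. The variable z enters the left side only through z^n / (q, Pz; q)_n. By
`sum_invTerm` this is a finite sum over k ≤ n of a very-well-poised factor in k times 1 / ((q;
q)_{n-k} (P; q)_{n+k}). After interchanging sums and setting n = k + l, the sum over l is the z = 1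
series with a replaced by a q^k: the inner ₃φ₂ respects this shift (`innerSum_add`), and P becomes P
q^{2k}. Its product value, divided by the value at k = 0, supplies the remaining factors of the k-th
term of the ₈W₇. For z = 1 (`tsum_mul_innerSum`), collect the double series by N = n + m. The sum at
fixed N is q-Pfaff–Saalschütz (`sum_saalTerm`); its numerator cancels (abcd, abcr; q)_N, and the
q-Gauss sum (`tsum_qGauss`) remains. -/

/-! ### Shifted factorials: algebra, limits and uniform bounds. -/

theorem qShift_zero_right (q x : ℂ) : qShift q x 0 = 1 := by simp [qShift]

theorem qShift_succ (q x : ℂ) (n : ℕ) : qShift q x (n + 1) = qShift q x n * (1 - x * q ^ n) := by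
  simp [qShift, Finset.prod_range_succ]

theorem qShift_add (q x : ℂ) (n m : ℕ) :
    qShift q x (n + m) = qShift q x n * qShift q (x * q ^ n) m := by
  simp only [qShift, Finset.prod_range_add]
  congr 1
  exact Finset.prod_congr rfl fun k _ => by ring

theorem qShift_ne_zero {q x : ℂ} (h : ∀ k : ℕ, 1 - x * q ^ k ≠ 0) (n : ℕ) : qShift q x n ≠ 0 :=
  Finset.prod_ne_zero_iff.2 fun k _ => h k

theorem one_sub_ne_zero_of_norm_lt {x : ℂ} (h : ‖x‖ < 1) : 1 - x ≠ 0 := by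
  intro h0
  rw [← sub_eq_zero.1 h0] at h
  simp at h

theorem norm_mul_pow_lt_one {q x : ℂ} (hq : ‖q‖ < 1) (hx : ‖x‖ < 1) (k : ℕ) : ‖x * q ^ k‖ < 1 := by
  rw [norm_mul, norm_pow]
  exact (mul_le_of_le_one_right (norm_nonneg _) (pow_le_one₀ (norm_nonneg _) hq.le)).trans_lt hx

theorem norm_mul_lt_one {x y : ℂ} (hx : ‖x‖ < 1) (hy : ‖y‖ < 1) : ‖x * y‖ < 1 := by
  rw [norm_mul]
  exact mul_lt_one_of_nonneg_of_lt_one_left (norm_nonneg _) hx hy.le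

theorem one_sub_mul_pow_ne_zero {q x : ℂ} (hq : ‖q‖ < 1) (hx : ‖x‖ < 1) (k : ℕ) :
    1 - x * q ^ k ≠ 0 :=
  one_sub_ne_zero_of_norm_lt (norm_mul_pow_lt_one hq hx k)

theorem qShift_ne_zero_of_norm_lt {q x : ℂ} (hq : ‖q‖ < 1) (hx : ‖x‖ < 1) (n : ℕ) :
    qShift q x n ≠ 0 :=
  qShift_ne_zero (one_sub_mul_pow_ne_zero hq hx) n

theorem summable_norm_neg_mul_pow {q : ℂ} (hq : ‖q‖ < 1) (x : ℂ) :
    Summable fun k : ℕ => ‖-(x * q ^ k)‖ := by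
  simp only [norm_neg, norm_mul, norm_pow]
  exact (summable_geometric_of_lt_one (norm_nonneg _) hq).mul_left _

theorem tendsto_qShift {q : ℂ} (hq : ‖q‖ < 1) (x : ℂ) :
    Filter.Tendsto (qShift q x) Filter.atTop (nhds (qShiftInf q x)) := by
  have h := (multipliable_one_add_of_summable (summable_norm_neg_mul_pow hq x)).hasProd
  simp only [← sub_eq_add_neg] at h
  exact h.tendsto_prod_nat

theorem qShiftInf_ne_zero {q x : ℂ} (hq : ‖q‖ < 1) (h : ∀ k : ℕ, 1 - x * q ^ k ≠ 0) :
    qShiftInf q x ≠ 0 := by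
  have := tprod_one_add_ne_zero_of_summable (f := fun k : ℕ => -(x * q ^ k))
    (by simpa only [← sub_eq_add_neg] using h) (summable_norm_neg_mul_pow hq x)
  simpa only [← sub_eq_add_neg, qShiftInf] using this

theorem qShiftInf_ne_zero_of_norm_lt {q x : ℂ} (hq : ‖q‖ < 1) (hx : ‖x‖ < 1) :
    qShiftInf q x ≠ 0 :=
  qShiftInf_ne_zero hq (one_sub_mul_pow_ne_zero hq hx)

theorem qShiftInf_eq_mul {q : ℂ} (hq : ‖q‖ < 1) (x : ℂ) (n : ℕ) :
    qShiftInf q x = qShift q x n * qShiftInf q (x * q ^ n) := by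
  refine tendsto_nhds_unique ((tendsto_qShift hq x).comp (Filter.tendsto_add_atTop_nat n)) ?_
  refine ((tendsto_qShift hq (x * q ^ n)).const_mul (qShift q x n)).congr fun m => ?_
  rw [← qShift_add, add_comm n m, Function.comp_apply]

/-- A convergent sequence is bounded. Over the filter `⊤`, `=O` is a bound uniform in every index,
so summability of single and double series follows by multiplying factorwise bounds. -/
theorem isBigO_qShift {ι : Type*} {q : ℂ} (hq : ‖q‖ < 1) (x : ℂ) (g : ι → ℕ) :
    (fun i => qShift q x (g i)) =O[⊤] fun _ => (1 : ℝ) := by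
  obtain ⟨C, hC⟩ := (Metric.isBounded_range_of_tendsto _ (tendsto_qShift hq x)).exists_norm_le
  exact .of_bound C (Filter.Eventually.of_forall fun i => by simpa using hC _ ⟨g i, rfl⟩)

/-- The reciprocals converge as well, since the infinite product is nonzero when no factor vanishes.
-/
theorem isBigO_inv_qShift {ι : Type*} {q x : ℂ} (hq : ‖q‖ < 1) (h : ∀ k : ℕ, 1 - x * q ^ k ≠ 0)
    (g : ι → ℕ) : (fun i => (qShift q x (g i))⁻¹) =O[⊤] fun _ => (1 : ℝ) := by
  obtain ⟨C, hC⟩ := (Metric.isBounded_range_of_tendsto _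
    ((tendsto_qShift hq x).inv₀ (qShiftInf_ne_zero hq h))).exists_norm_le
  exact .of_bound C (Filter.Eventually.of_forall fun i => by simpa using hC _ ⟨g i, rfl⟩)

theorem isBigO_inv_qShift_of_norm_lt {ι : Type*} {q x : ℂ} (hq : ‖q‖ < 1) (hx : ‖x‖ < 1)
    (g : ι → ℕ) : (fun i => (qShift q x (g i))⁻¹) =O[⊤] fun _ => (1 : ℝ) :=
  isBigO_inv_qShift hq (one_sub_mul_pow_ne_zero hq hx) g

theorem Asymptotics.IsBigO.mul_one_top {ι : Type*} {f g : ι → ℂ} {h : ι → ℝ}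
    (hf : f =O[⊤] h) (hg : g =O[⊤] fun _ => (1 : ℝ)) : (fun i => f i * g i) =O[⊤] h := by
  simpa using hf.mul hg

theorem isBigO_pow_top (w : ℂ) : (fun n : ℕ => w ^ n) =O[⊤] fun n => ‖w‖ ^ n :=
  .of_bound 1 (Filter.Eventually.of_forall fun n => by simp)

/-! ### The finite q-Pfaff–Saalschütz sum. -/

/-- Summand of the convolution form of the `q`-Pfaff–Saalschütz sum. -/
noncomputable def saalTerm (q x y w : ℂ) (n m : ℕ) : ℂ :=
  qShift q x n * qShift q y n * w ^ n * qShift q w m /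
    (qShift q q n * qShift q (x * y * w) n * qShift q q m)

/-- Creative telescoping: the left side sums the defect in the first-order recurrence in N satisfied
by the closed form, and the right side is its certificate. The range stops at k ≤ N because n = N +
1 occurs only in the sum of order N + 1. -/
theorem saalTerm_telescope {q x y w : ℂ} (hq : ∀ n, qShift q q n ≠ 0)
    (hP : ∀ n, qShift q (x * y * w) n ≠ 0) (k N : ℕ) (hk : k ≤ N) :
    ∑ n ∈ Finset.range (k + 1),
      ((1 - q ^ (N + 1)) * (1 - x * y * w * q ^ N) * saalTerm q x y w n (N + 1 - n) -
        (1 - x * w * q ^ N) * (1 - y * w * q ^ N) * saalTerm q x y w n (N - n)) =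
      -(q ^ (N - k) * (qShift q x (k + 1) * qShift q y (k + 1) * w ^ (k + 1) * qShift q w (N - k) /
        (qShift q q k * qShift q (x * y * w) k * qShift q q (N - k)))) := by
  induction k with
  | zero =>
    have h1 := hq (N + 1)
    have h2 := hq N
    rw [qShift_succ] at h1
    have h3 := right_ne_zero_of_mul h1
    simp only [zero_add, Finset.range_one, Finset.sum_singleton, saalTerm, Nat.sub_zero,
      qShift_succ, qShift_zero_right, pow_zero, mul_one]
    rw [← pow_succ'] at h3
    rw [← pow_succ' q N]
    generalize hd : 1 - q ^ (N + 1) = d at *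
    have h4 : qShift q q N * d ≠ 0 := mul_ne_zero h2 h3
    field_simp
    ring
  | succ k ih =>
    rw [Finset.sum_range_succ, ih (by omega)]
    obtain ⟨j, rfl⟩ := Nat.exists_eq_add_of_le hk
    rw [show k + 1 + j - (k + 1) = j by omega, show k + 1 + j + 1 - (k + 1) = j + 1 by omega,
      show k + 1 + j - k = j + 1 by omega]
    have h1 := hq (k + 1)
    have h2 := hq (j + 1)
    have h3 := hP (k + 1)
    have h4 := hq k
    have h5 := hq j
    have h6 := hP k
    rw [qShift_succ] at h1 h2 h3
    have h7 := right_ne_zero_of_mul h1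
    have h8 := right_ne_zero_of_mul h2
    have h9 := right_ne_zero_of_mul h3
    simp only [saalTerm, qShift_succ]
    -- The denominator factors stay atoms while fractions are cleared, so their nonvanishing is read
    -- off the hypotheses; they are expanded only for `ring`.
    generalize hd1 : 1 - q * q ^ k = d1 at *
    generalize hd2 : 1 - q * q ^ j = d2 at *
    generalize hd3 : 1 - x * y * w * q ^ k = d3 at *
    simp only [pow_succ, pow_add]
    generalize qShift q q k = u1 at *
    generalize qShift q q j = u2 at *
    generalize qShift q (x * y * w) k = u3 at *
    generalize qShift q x k = u4 at *
    generalize qShift q y k = u5 at *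
    generalize qShift q w j = u6 at *
    generalize q ^ k = u7 at *
    generalize q ^ j = u8 at *
    field_simp
    rw [← hd1, ← hd2, ← hd3]
    ring

theorem sum_saalTerm {q x y w : ℂ} (hq : ∀ n, qShift q q n ≠ 0)
    (hP : ∀ n, qShift q (x * y * w) n ≠ 0) (N : ℕ) :
    ∑ n ∈ Finset.range (N + 1), saalTerm q x y w n (N - n) =
      qShift q (x * w) N * qShift q (y * w) N / (qShift q q N * qShift q (x * y * w) N) := by
  induction N with
  | zero => simp [saalTerm, qShift_zero_right]
  | succ N ih =>
    have h := saalTerm_telescope hq hP N N le_rfl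
    rw [Finset.sum_sub_distrib, ← Finset.mul_sum, ← Finset.mul_sum, ih] at h
    rw [Finset.sum_range_succ]
    have h1 := hq (N + 1)
    have h3 := hP (N + 1)
    have h4 := hq N
    have h6 := hP N
    rw [qShift_succ] at h1 h3
    have h7 := right_ne_zero_of_mul h1
    have h9 := right_ne_zero_of_mul h3
    have h10 : (1 - q ^ (N + 1)) * (1 - x * y * w * q ^ N) ≠ 0 :=
      mul_ne_zero (by rwa [pow_succ']) h9
    rw [sub_eq_iff_eq_add] at h
    apply mul_left_cancel₀ h10
    -- The one summand outside the telescoped range, n = N + 1, cancels the boundary term.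
    rw [mul_add, h]
    simp only [saalTerm, qShift_succ, pow_succ', Nat.sub_self, qShift_zero_right, pow_zero]
    generalize 1 - q * q ^ N = d1 at *
    generalize 1 - x * y * w * q ^ N = d2 at *
    field_simp
    ring

/-! ### Very-well-poised expansion of the z-dependence. -/

/-- Summand of the expansion of `zⁿ / (q, P z; q)_n`, `P = A q`, in the functions
`(1/z; q)_k z^k / (P z; q)_k`. -/
noncomputable def invTerm (q A z : ℂ) (k m : ℕ) : ℂ :=
  qShift q A k * (1 - A * q ^ (2 * k)) / (qShift q q k * (1 - A)) *
    (qShift q (1 / z) k * z ^ k / qShift q (A * q * z) k) /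
      (qShift q q m * qShift q (A * q) (2 * k + m))

/-- The same method, for the recurrence in N satisfied by z^N / (q, Aqz; q)_N. -/
theorem invTerm_telescope {q A z : ℂ} (hz : z ≠ 0) (hq : ∀ n, qShift q q n ≠ 0)
    (hA : 1 - A ≠ 0) (hP : ∀ n, qShift q (A * q) n ≠ 0)
    (hPz : ∀ n, qShift q (A * q * z) n ≠ 0) (k N : ℕ) (hk : k ≤ N) :
    ∑ n ∈ Finset.range (k + 1),
      ((1 - A * q * z * q ^ N) * (1 - q ^ (N + 1)) * invTerm q A z n (N + 1 - n) -
        z * invTerm q A z n (N - n)) =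
      -(qShift q (A * q) k * (qShift q (1 / z) (k + 1) * z ^ (k + 1)) /
        (qShift q q k * qShift q (A * q * z) k * qShift q q (N - k) *
          qShift q (A * q) (N + k + 1))) := by
  induction k with
  | zero =>
    have h1 := hq (N + 1)
    have h2 := hq N
    have h3 := hP (N + 1)
    have h4 := hP N
    rw [qShift_succ] at h1 h3
    have h5 := right_ne_zero_of_mul h1
    have h6 := right_ne_zero_of_mul h3
    simp only [zero_add, Finset.range_one, Finset.sum_singleton, invTerm, Nat.sub_zero, mul_zero,
      add_zero, qShift_succ, qShift_zero_right, pow_zero, mul_one, one_mul, pow_succ']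
    generalize 1 - q * q ^ N = d1 at *
    generalize hd2 : 1 - A * q * q ^ N = d2 at *
    field_simp
    rw [← hd2]
    ring
  | succ k ih =>
    rw [Finset.sum_range_succ, ih (by omega)]
    obtain ⟨j, rfl⟩ := Nat.exists_eq_add_of_le hk
    -- Splitting off the first factor cancels the denominator `1 - A`.
    have hAk : qShift q A (k + 1) = (1 - A) * qShift q (A * q) k := by
      rw [add_comm, qShift_add]; simp [qShift]
    simp only [invTerm]
    rw [show k + 1 + j - (k + 1) = j by omega, show k + 1 + j + 1 - (k + 1) = j + 1 by omega,
      show k + 1 + j - k = j + 1 by omega, show k + 1 + j + k + 1 = 2 * k + j + 2 by omega,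
      show k + 1 + j + (k + 1) + 1 = 2 * k + j + 3 by omega,
      show 2 * (k + 1) + j = 2 * k + j + 2 by omega,
      show 2 * (k + 1) + (j + 1) = 2 * k + j + 3 by omega, hAk]
    have h1 := hq (k + 1)
    have h2 := hq (j + 1)
    have h3 := hPz (k + 1)
    have h4 := hq k
    have h5 := hq j
    have h6 := hPz k
    have h10 := hP (2 * k + j + 3)
    have h11 := hP (2 * k + j + 2)
    rw [qShift_succ] at h1 h2 h3 h10
    have h7 := right_ne_zero_of_mul h1
    have h8 := right_ne_zero_of_mul h2
    have h9 := right_ne_zero_of_mul h3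
    have h12 := right_ne_zero_of_mul h10
    rw [qShift_succ q (A * q) (2 * k + j + 2), qShift_succ q q k, qShift_succ q q j,
      qShift_succ q (A * q * z) k, qShift_succ q (1 / z) (k + 1), qShift_succ q (1 / z) k,
      qShift_succ q (A * q) k]
    generalize hd1 : 1 - q * q ^ k = d1 at *
    generalize hd2 : 1 - q * q ^ j = d2 at *
    generalize hd3 : 1 - A * q * z * q ^ k = d3 at *
    generalize hd4 : 1 - A * q * q ^ (2 * k + j + 2) = d4 at *
    generalize qShift q (A * q) (2 * k + j + 2) = u6 at *
    simp only [pow_succ, pow_add, two_mul, mul_add, mul_one] at hd4 ⊢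
    generalize qShift q q k = u1 at *
    generalize qShift q q j = u2 at *
    generalize qShift q (A * q * z) k = u3 at *
    generalize qShift q (1 / z) k = u4 at *
    generalize qShift q (A * q) k = u5 at *
    generalize q ^ k = u7 at *
    generalize q ^ j = u8 at *
    generalize z ^ k = u9 at *
    field_simp
    rw [← hd1, ← hd2, ← hd3, ← hd4]
    ring

/-- This is the limit c → 0 of the terminating very-well-poised ₆φ₅ sum with parameters 1/z, c,
q^{-N}. -/
theorem sum_invTerm {q A z : ℂ} (hz : z ≠ 0) (hq : ∀ n, qShift q q n ≠ 0)
    (hA : 1 - A ≠ 0) (hP : ∀ n, qShift q (A * q) n ≠ 0)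
    (hPz : ∀ n, qShift q (A * q * z) n ≠ 0) (N : ℕ) :
    ∑ n ∈ Finset.range (N + 1), invTerm q A z n (N - n) =
      z ^ N / (qShift q q N * qShift q (A * q * z) N) := by
  induction N with
  | zero => simp [invTerm, qShift_zero_right, hA]
  | succ N ih =>
    have h := invTerm_telescope hz hq hA hP hPz N N le_rfl
    rw [Finset.sum_sub_distrib, ← Finset.mul_sum, ← Finset.mul_sum, ih] at h
    rw [Finset.sum_range_succ]
    have h1 := hq (N + 1)
    have h3 := hPz (N + 1)
    have h4 := hq N
    have h6 := hPz N
    have h11 := hP (2 * N + 2)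
    rw [show 2 * N + 2 = 2 * N + 1 + 1 by ring, qShift_succ] at h11
    have h12 := left_ne_zero_of_mul h11
    have h13 := right_ne_zero_of_mul h11
    rw [qShift_succ] at h1 h3
    have h7 := right_ne_zero_of_mul h1
    have h9 := right_ne_zero_of_mul h3
    have h10 : (1 - A * q * z * q ^ N) * (1 - q ^ (N + 1)) ≠ 0 :=
      mul_ne_zero h9 (by rwa [pow_succ'])
    have hAk : qShift q A (N + 1) = (1 - A) * qShift q (A * q) N := by
      rw [add_comm, qShift_add]; simp [qShift]
    rw [sub_eq_iff_eq_add] at h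
    apply mul_left_cancel₀ h10
    rw [mul_add, h]
    simp only [invTerm, hAk, Nat.sub_self, qShift_zero_right, add_zero]
    rw [show N + N + 1 = 2 * N + 1 by ring, show 2 * (N + 1) = 2 * N + 1 + 1 by ring,
      qShift_succ q (A * q) (2 * N + 1), qShift_succ q q N, qShift_succ q (A * q * z) N]
    generalize hd4 : 1 - A * q * q ^ (2 * N + 1) = d4 at *
    rw [show 1 - A * q ^ (2 * N + 1 + 1) = d4 by rw [← hd4]; ring]
    simp only [pow_succ]
    field_simp
    ring

/-! ### Rearrangement of double series and the q-Gauss sum. -/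

theorem summable_of_isBigO_geometric {f : ℕ → ℂ} {w : ℂ} (hw : ‖w‖ < 1)
    (h : f =O[⊤] fun n => ‖w‖ ^ n) : Summable f :=
  summable_of_isBigO_nat (summable_geometric_of_lt_one (norm_nonneg _) hw) (h.mono le_top)

theorem summable_of_isBigO_geometric_prod {f : ℕ × ℕ → ℂ} {v w : ℂ} (hv : ‖v‖ < 1) (hw : ‖w‖ < 1)
    (h : f =O[⊤] fun p => ‖v‖ ^ p.1 * ‖w‖ ^ p.2) : Summable f :=
  summable_of_isBigO ((summable_geometric_of_lt_one (norm_nonneg _) hv).mul_of_nonneg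
    (summable_geometric_of_lt_one (norm_nonneg _) hw) (fun _ => by positivity)
    (fun _ => by positivity)) (h.mono le_top)

theorem isBigO_pow_mul_pow_top (v w : ℂ) :
    (fun p : ℕ × ℕ => v ^ p.1 * w ^ p.2) =O[⊤] fun p => ‖v‖ ^ p.1 * ‖w‖ ^ p.2 :=
  .of_bound 1 (Filter.Eventually.of_forall fun n => by simp)

theorem tsum_sum_range_eq_tsum_tsum {f : ℕ → ℕ → ℂ} (hf : Summable fun p : ℕ × ℕ => f p.1 p.2) :
    ∑' n, ∑ k ∈ Finset.range (n + 1), f k (n - k) = ∑' k, ∑' l, f k l := by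
  rw [← hf.tsum_prod' fun k => hf.prod_factor k,
    ← Finset.HasAntidiagonal.sigmaAntidiagonalEquivProd.tsum_eq fun p : ℕ × ℕ => f p.1 p.2]
  refine Eq.trans (tsum_congr fun n => ?_) (Summable.tsum_sigma'
    (fun n => (hasSum_fintype _).summable)
    (Finset.HasAntidiagonal.sigmaAntidiagonalEquivProd.summable_iff.2 hf)).symm
  rw [tsum_fintype, ← Finset.Nat.sum_antidiagonal_eq_sum_range_succ f]
  exact (Finset.sum_coe_sort (Finset.HasAntidiagonal.antidiagonal n) fun p : ℕ × ℕ => f p.1 p.2).symm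

/-- The `q`-Gauss sum. -/
theorem tsum_qGauss {q x y w : ℂ} (hq : ‖q‖ < 1) (hw : ‖w‖ < 1) (hP : ‖x * y * w‖ < 1) :
    ∑' n, qShift q x n * qShift q y n * w ^ n / (qShift q q n * qShift q (x * y * w) n) =
      qShiftInf q (x * w) * qShiftInf q (y * w) / (qShiftInf q (x * y * w) * qShiftInf q w) := by
  set t : ℕ → ℂ := fun n =>
    qShift q x n * qShift q y n * w ^ n / (qShift q q n * qShift q (x * y * w) n) with ht
  have htO : t =O[⊤] fun n => ‖w‖ ^ n := by
    refine (((((isBigO_pow_top w).mul_one_top (isBigO_qShift hq x id)).mul_one_top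
      (isBigO_qShift hq y id)).mul_one_top (isBigO_inv_qShift_of_norm_lt hq hq id)).mul_one_top
      (isBigO_inv_qShift_of_norm_lt hq hP id)).congr_left fun n => ?_
    simp only [ht, id, div_eq_mul_inv, mul_inv]
    ring
  obtain ⟨C, hC⟩ := htO.bound
  rw [Filter.eventually_top] at hC
  obtain ⟨K, hK⟩ := ((isBigO_qShift hq w id).mul_one_top
    (isBigO_inv_qShift_of_norm_lt hq hq id)).bound
  rw [Filter.eventually_top] at hK
  simp only [id, norm_one, mul_one, ← div_eq_mul_inv, norm_pow, norm_norm] at hK hC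
  -- Tannery's theorem: N → ∞ in the finite Saalschütz sum, where (w; q)_{N-n} / (q; q)_{N-n} tends
  -- to (w; q)_∞ / (q; q)_∞ for each n.
  have hlim := tendsto_tsum_of_dominated_convergence (𝓕 := Filter.atTop)
    (f := fun N n => if n ≤ N then t n * (qShift q w (N - n) / qShift q q (N - n)) else 0)
    (g := fun n => t n * (qShiftInf q w / qShiftInf q q)) (bound := fun n => C * ‖w‖ ^ n * K)
    (((summable_geometric_of_lt_one (norm_nonneg _) hw).mul_left C).mul_right K) (fun n => by
      have h := ((tendsto_qShift hq w).div (tendsto_qShift hq q)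
        (qShiftInf_ne_zero_of_norm_lt hq hq)).comp (Filter.tendsto_sub_atTop_nat n)
      refine (h.const_mul (t n)).congr' ?_
      filter_upwards [Filter.eventually_ge_atTop n] with N hN
      simp [hN]) (Filter.Eventually.of_forall fun N n => by
      have h0 : ‖t n‖ * ‖qShift q w (N - n) / qShift q q (N - n)‖ ≤ C * ‖w‖ ^ n * K :=
        mul_le_mul (hC n) (hK _) (norm_nonneg _) ((norm_nonneg _).trans (hC n))
      split_ifs
      · rwa [norm_mul]
      · rw [norm_zero]
        exact (by positivity : (0 : ℝ) ≤ _).trans h0)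
  have hfin : ∀ N, (∑' n, if n ≤ N then t n * (qShift q w (N - n) / qShift q q (N - n)) else 0) =
      qShift q (x * w) N * qShift q (y * w) N / (qShift q q N * qShift q (x * y * w) N) := by
    intro N
    rw [← sum_saalTerm (qShift_ne_zero_of_norm_lt hq hq) (qShift_ne_zero_of_norm_lt hq hP) N,
      tsum_eq_sum (s := Finset.range (N + 1))]
    · refine Finset.sum_congr rfl fun n hn => ?_
      rw [if_pos (Nat.lt_succ_iff.1 (Finset.mem_range.1 hn)), saalTerm, ht, div_mul_div_comm]
    · intro n hn
      rw [if_neg fun h => hn (Finset.mem_range.2 (Nat.lt_succ_iff.2 h))]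
  simp only [hfin] at hlim
  have hq0 := qShiftInf_ne_zero_of_norm_lt hq hq
  have hw0 := qShiftInf_ne_zero_of_norm_lt hq hw
  have hP0 := qShiftInf_ne_zero_of_norm_lt hq hP
  have := tendsto_nhds_unique hlim
    (((tendsto_qShift hq (x * w)).mul (tendsto_qShift hq (y * w))).div
      ((tendsto_qShift hq q).mul (tendsto_qShift hq (x * y * w))) (mul_ne_zero hq0 hP0))
  rw [tsum_mul_right] at this
  field_simp at this ⊢
  linear_combination this


/-! ### The inner ₃φ₂ and the case z = 1. -/

/-- The coefficient of `(d r) ^ m` in the inner `₃φ₂` with parameters shifted by `q ^ n`, after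
absorbing the shifted factorials of length `n`. -/
noncomputable def innerCoeff (q a b c d r : ℂ) (n m : ℕ) : ℂ :=
  qShift q (a * b) (n + m) * qShift q (a * c) (n + m) * qShift q (b * c) m /
    (qShift q (a * b * c * d) (n + m) * qShift q (a * b * c * r) (n + m) * qShift q q m)

/-- The inner `₃φ₂` with the shifted factorials of length `n` absorbed. -/
noncomputable def innerSum (q a b c d r : ℂ) (n : ℕ) : ℂ :=
  ∑' m, innerCoeff q a b c d r n m * (d * r) ^ m

theorem isBigO_innerCoeff {q a b c d r : ℂ} (hq : ‖q‖ < 1) (ha : ‖a‖ < 1) (hb : ‖b‖ < 1)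
    (hc : ‖c‖ < 1) (hd : ‖d‖ < 1) (hr : ‖r‖ < 1) {ι : Type*} (g m : ι → ℕ) :
    (fun i => innerCoeff q a b c d r (g i) (m i)) =O[⊤] fun _ => (1 : ℝ) := by
  have habc := norm_mul_lt_one (norm_mul_lt_one ha hb) hc
  refine ((((((isBigO_qShift hq (a * b) fun i => g i + m i).mul_one_top
    (isBigO_qShift hq (a * c) fun i => g i + m i)).mul_one_top
    (isBigO_qShift hq (b * c) m)).mul_one_top
    (isBigO_inv_qShift_of_norm_lt hq (norm_mul_lt_one habc hd) fun i => g i + m i)).mul_one_top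
    (isBigO_inv_qShift_of_norm_lt hq (norm_mul_lt_one habc hr) fun i => g i + m i)).mul_one_top
    (isBigO_inv_qShift_of_norm_lt hq hq m)).congr_left fun i => ?_
  simp only [innerCoeff, div_eq_mul_inv, mul_inv]
  ring

theorem isBigO_innerSum {q a b c d r : ℂ} (hq : ‖q‖ < 1) (ha : ‖a‖ < 1) (hb : ‖b‖ < 1)
    (hc : ‖c‖ < 1) (hd : ‖d‖ < 1) (hr : ‖r‖ < 1) {ι : Type*} (g : ι → ℕ) :
    (fun i => innerSum q a b c d r (g i)) =O[⊤] fun _ => (1 : ℝ) := by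
  obtain ⟨C, hC⟩ := (isBigO_innerCoeff hq ha hb hc hd hr (ι := ℕ × ℕ) Prod.fst Prod.snd).bound
  rw [Filter.eventually_top] at hC
  refine .of_bound (C * (1 - ‖d * r‖)⁻¹) (Filter.Eventually.of_forall fun i => ?_)
  rw [norm_one, mul_one]
  refine tsum_of_norm_bounded ((hasSum_geometric_of_lt_one (norm_nonneg _)
    (norm_mul_lt_one hd hr)).mul_left C) fun m => ?_
  rw [norm_mul, norm_pow]
  exact mul_le_mul_of_nonneg_right (by simpa using hC (g i, m)) (by positivity)

/-- The parameters ab, ac, abcd, abcr are linear in a and bc is free of a, so advancing the index by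
k amounts to a ↦ a q^k. -/
theorem innerSum_add {q a b c d r : ℂ} (k l : ℕ) :
    innerSum q a b c d r (k + l) =
      qShift q (a * b) k * qShift q (a * c) k /
        (qShift q (a * b * c * d) k * qShift q (a * b * c * r) k) *
      innerSum q (a * q ^ k) b c d r l := by
  rw [innerSum, innerSum, ← tsum_mul_left]
  refine tsum_congr fun m => ?_
  simp only [innerCoeff, add_assoc, qShift_add q _ k]
  rw [show a * b * q ^ k = a * q ^ k * b by ring, show a * c * q ^ k = a * q ^ k * c by ring,
    show a * b * c * d * q ^ k = a * q ^ k * b * c * d by ring,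
    show a * b * c * r * q ^ k = a * q ^ k * b * c * r by ring]
  simp only [div_eq_mul_inv, mul_inv]
  ring

theorem phiTerm_three_two (q u₁ u₂ u₃ v₁ v₂ s : ℂ) (n : ℕ) :
    phiTerm [u₁, u₂, u₃] [v₁, v₂] q s n =
      qShift q u₁ n * qShift q u₂ n * qShift q u₃ n * s ^ n /
        (qShift q q n * qShift q v₁ n * qShift q v₂ n) := by
  simp [phiTerm, qShiftMul, mul_assoc]

theorem mul_phi_eq_innerSum (q a b c d r : ℂ) (n : ℕ) :
    qShift q (a * b) n * qShift q (a * c) n /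
        (qShift q (a * b * c * d) n * qShift q (a * b * c * r) n) *
      phi [a * b * q ^ n, a * c * q ^ n, b * c] [a * b * c * d * q ^ n, a * b * c * r * q ^ n] q
        (d * r) = innerSum q a b c d r n := by
  rw [phi, innerSum, ← tsum_mul_left]
  refine tsum_congr fun m => ?_
  simp only [innerCoeff, qShift_add q _ n, phiTerm_three_two, div_eq_mul_inv, mul_inv]
  ring

theorem summable_phiTerm_three_two {q u₁ u₂ u₃ v₁ v₂ s : ℂ} (hq : ‖q‖ < 1) (hv₁ : ‖v₁‖ < 1)
    (hv₂ : ‖v₂‖ < 1) (hs : ‖s‖ < 1) : Summable (phiTerm [u₁, u₂, u₃] [v₁, v₂] q s) := by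
  refine summable_of_isBigO_geometric hs ((((((((isBigO_pow_top s).mul_one_top
    (isBigO_qShift hq u₁ id)).mul_one_top (isBigO_qShift hq u₂ id)).mul_one_top
    (isBigO_qShift hq u₃ id)).mul_one_top
    (isBigO_inv_qShift_of_norm_lt hq hq id)).mul_one_top
    (isBigO_inv_qShift_of_norm_lt hq hv₁ id)).mul_one_top
    (isBigO_inv_qShift_of_norm_lt hq hv₂ id)).congr_left fun n => ?_)
  simp only [phiTerm_three_two, id, div_eq_mul_inv, mul_inv]
  ring

/-- The case `z = 1` of the double series evaluation. -/
theorem tsum_mul_innerSum {q a b c d r : ℂ} (hq : ‖q‖ < 1) (ha : ‖a‖ < 1) (hb : ‖b‖ < 1)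
    (hc : ‖c‖ < 1) (hd : ‖d‖ < 1) (hr : ‖r‖ < 1) :
    ∑' n, qShift q (a * d) n * qShift q (a * r) n * (b * c * d * r) ^ n /
        (qShift q q n * qShift q (a ^ 2 * b * c * d * r) n) * innerSum q a b c d r n =
      qShiftInf q (a * b * d * r) * qShiftInf q (a * c * d * r) /
        (qShiftInf q (d * r) * qShiftInf q (a ^ 2 * b * c * d * r)) := by
  have hX : ‖b * c * d * r‖ < 1 :=
    norm_mul_lt_one (norm_mul_lt_one (norm_mul_lt_one hb hc) hd) hr
  have habc := norm_mul_lt_one (norm_mul_lt_one ha hb) hc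
  have habcd := norm_mul_lt_one habc hd
  have habcr := norm_mul_lt_one habc hr
  have hP : ‖a ^ 2 * b * c * d * r‖ < 1 := by
    rw [show a ^ 2 * b * c * d * r = a * (a * (b * c * d * r)) by ring]
    exact norm_mul_lt_one ha (norm_mul_lt_one ha hX)
  set f : ℕ → ℕ → ℂ := fun n m => qShift q (a * d) n * qShift q (a * r) n * (b * c * d * r) ^ n /
    (qShift q q n * qShift q (a ^ 2 * b * c * d * r) n) *
      (innerCoeff q a b c d r n m * (d * r) ^ m) with hf
  have hsum : Summable fun p : ℕ × ℕ => f p.1 p.2 := by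
    refine summable_of_isBigO_geometric_prod hX (norm_mul_lt_one hd hr)
      (((((((isBigO_pow_mul_pow_top _ _).mul_one_top
        (isBigO_qShift hq (a * d) Prod.fst)).mul_one_top
        (isBigO_qShift hq (a * r) Prod.fst)).mul_one_top
        (isBigO_inv_qShift_of_norm_lt hq hq Prod.fst)).mul_one_top
        (isBigO_inv_qShift_of_norm_lt hq hP Prod.fst)).mul_one_top
        (isBigO_innerCoeff hq ha hb hc hd hr Prod.fst Prod.snd)).congr_left fun p => ?_)
    simp only [hf, div_eq_mul_inv, mul_inv]
    ring
  have h1 : ∀ n, qShift q (a * d) n * qShift q (a * r) n * (b * c * d * r) ^ n /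
        (qShift q q n * qShift q (a ^ 2 * b * c * d * r) n) * innerSum q a b c d r n =
      ∑' m, f n m := fun n => by rw [innerSum, ← tsum_mul_left]
  have hs : a * d * (a * r) * (b * c) = a ^ 2 * b * c * d * r := by ring
  -- Apart from (bc; q)_m / (q; q)_m, `innerCoeff` depends only on n + m. What remains at fixed N is
  -- Saalschütz with x = ad, y = ar, w = bc, for which xw = abcd and yw = abcr.
  have h2 : ∀ N, ∑ n ∈ Finset.range (N + 1), f n (N - n) =
      qShift q (a * b) N * qShift q (a * c) N * (d * r) ^ N /
        (qShift q q N * qShift q (a * b * (a * c) * (d * r)) N) := by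
    intro N
    have h3 : ∀ n ∈ Finset.range (N + 1), f n (N - n) =
        qShift q (a * b) N * qShift q (a * c) N * (d * r) ^ N /
          (qShift q (a * b * c * d) N * qShift q (a * b * c * r) N) *
        saalTerm q (a * d) (a * r) (b * c) n (N - n) := by
      intro n hn
      obtain ⟨m, rfl⟩ := Nat.exists_eq_add_of_le (Nat.lt_succ_iff.1 (Finset.mem_range.1 hn))
      simp only [hf, innerCoeff, saalTerm, hs, Nat.add_sub_cancel_left, div_eq_mul_inv, mul_inv]
      ring
    rw [Finset.sum_congr rfl h3, ← Finset.mul_sum,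
      sum_saalTerm (qShift_ne_zero_of_norm_lt hq hq) (by
        rw [hs]; exact qShift_ne_zero_of_norm_lt hq hP), hs,
      show a * b * (a * c) * (d * r) = a ^ 2 * b * c * d * r by ring,
      show a * d * (b * c) = a * b * c * d by ring, show a * r * (b * c) = a * b * c * r by ring]
    have h4 := qShift_ne_zero_of_norm_lt hq habcd N
    have h5 := qShift_ne_zero_of_norm_lt hq habcr N
    field_simp
  have hs' : a * b * (a * c) * (d * r) = a ^ 2 * b * c * d * r := by ring
  rw [tsum_congr h1, ← tsum_sum_range_eq_tsum_tsum hsum, tsum_congr h2,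
    tsum_qGauss hq (norm_mul_lt_one hd hr) (by rwa [hs']), hs', ← mul_assoc, ← mul_assoc,
    mul_comm (qShiftInf q (d * r))]

/-! ### Terms of the very-well-poised series. -/

/-- The very-well-poised factor attached to the parameters `A` and `1 / z`, where the square-root
parameters have been combined into `(1 - A q^{2k}) / (1 - A)`. -/
noncomputable def vwpFactor (q A z : ℂ) (k : ℕ) : ℂ :=
  qShift q A k * (1 - A * q ^ (2 * k)) / (qShift q q k * (1 - A)) *
    (qShift q (1 / z) k / qShift q (A * q * z) k)

theorem invTerm_eq_vwpFactor (q A z : ℂ) (k m : ℕ) :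
    invTerm q A z k m = vwpFactor q A z k * z ^ k * (qShift q q m)⁻¹ *
      (qShift q (A * q) (2 * k + m))⁻¹ := by
  simp only [invTerm, vwpFactor, div_eq_mul_inv, mul_inv]
  ring

theorem isBigO_vwpFactor {q A z : ℂ} {ι : Type*} (hq : ‖q‖ < 1) (hPz : ‖A * q * z‖ < 1)
    (g : ι → ℕ) : (fun i => vwpFactor q A z (g i)) =O[⊤] fun _ => (1 : ℝ) := by
  have h1 : (fun i => 1 - A * q ^ (2 * g i)) =O[⊤] fun _ => (1 : ℝ) := by
    refine .of_bound (1 + ‖A‖) (Filter.Eventually.of_forall fun i => ?_)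
    rw [norm_one, mul_one]
    refine (norm_sub_le _ _).trans ?_
    rw [norm_one, norm_mul, norm_pow]
    gcongr
    exact mul_le_of_le_one_right (norm_nonneg _) (pow_le_one₀ (norm_nonneg _) hq.le)
  refine ((((((isBigO_qShift hq A g).mul_one_top h1).mul_one_top
    (isBigO_inv_qShift_of_norm_lt hq hq g)).mul_one_top
    (isBigO_qShift hq (1 / z) g)).mul_one_top
    (isBigO_inv_qShift_of_norm_lt hq hPz g)).mul_one_top
    (Asymptotics.isBigO_const_const ((1 - A)⁻¹) one_ne_zero _)).congr_left fun i => ?_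
  simp only [vwpFactor, div_eq_mul_inv, mul_inv]
  ring

theorem qShift_mul_div_shift {q x : ℂ} (hx : 1 - x ≠ 0) (n : ℕ) :
    qShift q (q * x) n = qShift q x n * (1 - x * q ^ n) / (1 - x) := by
  rw [← qShift_succ, add_comm, qShift_add, mul_comm q x]
  simp [qShift, hx]

theorem qShift_mul_qShift_neg (q s : ℂ) (n : ℕ) :
    qShift q s n * qShift q (-s) n = ∏ k ∈ Finset.range n, (1 - s ^ 2 * q ^ (2 * k)) := by
  rw [qShift, qShift, ← Finset.prod_mul_distrib]
  exact Finset.prod_congr rfl fun k _ => by ring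

/-- Pairing s with -s leaves products in s² alone, so the choice of square root is immaterial, and
the quotient telescopes to its end factors. -/
theorem very_well_poised_ratio {q s A : ℂ} (hs : s ^ 2 = A)
    (hA : ∀ k, 1 - A * q ^ (2 * k) ≠ 0) (n : ℕ) :
    qShift q (q * s) n * qShift q (-(q * s)) n / (qShift q s n * qShift q (-s) n) =
      (1 - A * q ^ (2 * n)) / (1 - A) := by
  have h0 : (1 - s) * (1 - -s) ≠ 0 := by
    have := hA 0
    rw [← hs] at this
    convert this using 1
    ring
  have h1 : qShift q s n * qShift q (-s) n ≠ 0 := by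
    rw [qShift_mul_qShift_neg, hs]
    exact Finset.prod_ne_zero_iff.2 fun k _ => hA k
  have h2 := left_ne_zero_of_mul h0
  have h3 := right_ne_zero_of_mul h0
  have h4 := left_ne_zero_of_mul h1
  have h5 := right_ne_zero_of_mul h1
  rw [← mul_neg, qShift_mul_div_shift h2, qShift_mul_div_shift h3, ← hs,
    show 1 - s ^ 2 = (1 - s) * (1 - -s) by ring,
    show 1 - s ^ 2 * q ^ (2 * n) = (1 - s * q ^ n) * (1 - -s * q ^ n) by ring]
  generalize 1 - -s = t at *
  field_simp

theorem vwpTerm_eq {q a b c d r z : ℂ} (hq0 : q ≠ 0)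
    (hA : ∀ k, 1 - a ^ 2 * b * c * d * r / q * q ^ (2 * k) ≠ 0) (n : ℕ) :
    vwpTerm (a ^ 2 * b * c * d * r / q) [a * b, a * c, a * d, a * r, 1 / z] q
        (b * c * d * r * z) n =
      vwpFactor q (a ^ 2 * b * c * d * r / q) z n *
        (qShift q (a * b) n * qShift q (a * c) n * qShift q (a * d) n * qShift q (a * r) n /
          (qShift q (a * b * c * d) n * qShift q (a * b * c * r) n * qShift q (a * b * d * r) n *
            qShift q (a * c * d * r) n)) * (b * c * d * r * z) ^ n := by
  set A := a ^ 2 * b * c * d * r / q with hAdef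
  have hratio := very_well_poised_ratio (s := A ^ (1 / 2 : ℂ)) (by
    rw [one_div]; exact_mod_cast Complex.cpow_nat_inv_pow A two_ne_zero) hA n
  -- Degenerate parameters: if any of b, c, d, r, z vanishes, only n = 0 contributes. If only a = 0,
  -- then A = 0 and division by zero gives lower parameters 0, which are the intended values.
  have hX : n = 0 ∨ b * c * d * r * z = 0 ∨
      (q * A / (a * b) = a * c * d * r ∧ q * A / (a * c) = a * b * d * r ∧
        q * A / (a * d) = a * b * c * r ∧ q * A / (a * r) = a * b * c * d) := by
    by_cases hX : b * c * d * r * z = 0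
    · exact .inr (.inl hX)
    refine .inr (.inr ?_)
    simp only [mul_eq_zero, not_or] at hX
    obtain ⟨⟨⟨⟨hb, hc⟩, hd⟩, hr⟩, -⟩ := hX
    rw [hAdef]
    by_cases ha : a = 0
    · simp [ha]
    · refine ⟨?_, ?_, ?_, ?_⟩ <;> field_simp
  rcases Nat.eq_zero_or_pos n with rfl | hn
  · have := hA 0
    simp only [mul_zero, pow_zero, mul_one] at this
    simp [vwpTerm, phiTerm, qShiftMul, vwpFactor, qShift_zero_right, vwpUpper, vwpLower, this]
  rcases hX with rfl | hX | ⟨h1, h2, h3, h4⟩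
  · exact absurd hn (lt_irrefl 0)
  · simp [vwpTerm, phiTerm, hX, zero_pow hn.ne']
  · simp only [vwpTerm, phiTerm, vwpUpper, vwpLower, qShiftMul, List.map_cons, List.map_nil,
      List.prod_cons, List.prod_nil, h1, h2, h3, h4, vwpFactor]
    rw [show q * A / (1 / z) = A * q * z by rw [one_div, div_inv_eq_mul, mul_comm q],
      mul_div_mul_comm (qShift q A n), ← hratio]
    simp only [div_eq_mul_inv, mul_inv]
    ring

/-! ### Assembly: the sum over l at fixed k, and the theorem. -/

theorem tsum_vwpFactor_mul_innerSum {q a b c d r z : ℂ} (hq0 : q ≠ 0) (hq : ‖q‖ < 1) (ha : ‖a‖ < 1)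
    (hb : ‖b‖ < 1) (hc : ‖c‖ < 1) (hd : ‖d‖ < 1) (hr : ‖r‖ < 1) (k : ℕ) :
    ∑' l, qShift q (a * d) (k + l) * qShift q (a * r) (k + l) * (b * c * d * r) ^ (k + l) *
        invTerm q (a ^ 2 * b * c * d * r / q) z k l * innerSum q a b c d r (k + l) =
      qShiftInf q (a * b * d * r) * qShiftInf q (a * c * d * r) /
        (qShiftInf q (d * r) * qShiftInf q (a ^ 2 * b * c * d * r)) *
      (vwpFactor q (a ^ 2 * b * c * d * r / q) z k *
        (qShift q (a * b) k * qShift q (a * c) k * qShift q (a * d) k * qShift q (a * r) k /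
          (qShift q (a * b * c * d) k * qShift q (a * b * c * r) k * qShift q (a * b * d * r) k *
            qShift q (a * c * d * r) k)) * (b * c * d * r * z) ^ k) := by
  have hD := tsum_mul_innerSum hq (norm_mul_pow_lt_one hq ha k) hb hc hd hr
  have hX : ‖b * c * d * r‖ < 1 :=
    norm_mul_lt_one (norm_mul_lt_one (norm_mul_lt_one hb hc) hd) hr
  have hP : ‖a ^ 2 * b * c * d * r‖ < 1 := by
    rw [show a ^ 2 * b * c * d * r = a * (a * (b * c * d * r)) by ring]
    exact norm_mul_lt_one ha (norm_mul_lt_one ha hX)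
  have habdr := norm_mul_lt_one (norm_mul_lt_one (norm_mul_lt_one ha hb) hd) hr
  have hacdr := norm_mul_lt_one (norm_mul_lt_one (norm_mul_lt_one ha hc) hd) hr
  -- Splitting the infinite products exposes those of the shifted evaluation; P splits after 2k
  -- factors because it is quadratic in a.
  rw [qShiftInf_eq_mul hq (a * b * d * r) k, qShiftInf_eq_mul hq (a * c * d * r) k,
    qShiftInf_eq_mul hq (a ^ 2 * b * c * d * r) (2 * k)]
  have h1 := qShift_ne_zero_of_norm_lt hq habdr k
  have h2 := qShift_ne_zero_of_norm_lt hq hacdr k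
  rw [show a * q ^ k * b * d * r = a * b * d * r * q ^ k by ring,
    show a * q ^ k * c * d * r = a * c * d * r * q ^ k by ring,
    show (a * q ^ k) ^ 2 * b * c * d * r = a ^ 2 * b * c * d * r * q ^ (2 * k) by ring] at hD
  have hterm : ∀ l, qShift q (a * d) (k + l) * qShift q (a * r) (k + l) *
        (b * c * d * r) ^ (k + l) *
        invTerm q (a ^ 2 * b * c * d * r / q) z k l * innerSum q a b c d r (k + l) =
      vwpFactor q (a ^ 2 * b * c * d * r / q) z k * (b * c * d * r * z) ^ k *
        (qShift q (a * b) k * qShift q (a * c) k * qShift q (a * d) k * qShift q (a * r) k /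
          (qShift q (a * b * c * d) k * qShift q (a * b * c * r) k *
            qShift q (a ^ 2 * b * c * d * r) (2 * k))) *
      (qShift q (a * q ^ k * d) l * qShift q (a * q ^ k * r) l * (b * c * d * r) ^ l /
        (qShift q q l * qShift q (a ^ 2 * b * c * d * r * q ^ (2 * k)) l) *
          innerSum q (a * q ^ k) b c d r l) := by
    intro l
    rw [innerSum_add, invTerm_eq_vwpFactor, div_mul_cancel₀ _ hq0, qShift_add q (a * d) k,
      qShift_add q (a * r) k, qShift_add q _ (2 * k),
      show a * d * q ^ k = a * q ^ k * d by ring, show a * r * q ^ k = a * q ^ k * r by ring]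
    simp only [div_eq_mul_inv, mul_inv, mul_pow, pow_add]
    ring
  rw [tsum_congr hterm, tsum_mul_left, hD]
  generalize qShift q (a * b * d * r) k = u at *
  generalize qShift q (a * c * d * r) k = v at *
  generalize qShift q (a ^ 2 * b * c * d * r) (2 * k) = p
  generalize qShift q (a * b * c * d) k * qShift q (a * b * c * r) k = D
  generalize qShift q (a * b) k * qShift q (a * c) k * qShift q (a * d) k * qShift q (a * r) k = N
  generalize vwpFactor q (a ^ 2 * b * c * d * r / q) z k = F
  generalize (b * c * d * r * z) ^ k = Z
  generalize qShiftInf q (a * b * d * r * q ^ k) = I₁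
  generalize qShiftInf q (a * c * d * r * q ^ k) = I₂
  generalize qShiftInf q (a ^ 2 * b * c * d * r * q ^ (2 * k)) = J₁
  generalize qShiftInf q (d * r) = J₂
  field_simp

theorem theorem6p2 (q : ℝ) (hq0 : 0 < q) (hq1 : q < 1) (a b c d r z : ℂ)
    (ha : ‖a‖ < 1) (hb : ‖b‖ < 1) (hc : ‖c‖ < 1) (hd : ‖d‖ < 1) (hr : ‖r‖ < 1)
    (hz : z ≠ 0) (hconv : ‖b * c * d * r * z‖ < 1)
    (hpole : a ^ 2 * b * c * d * r ≠ (q : ℂ)) :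
    (∀ n : ℕ, Summable (phiTerm [a * b * (q : ℂ) ^ n, a * c * (q : ℂ) ^ n, b * c]
      [a * b * c * d * (q : ℂ) ^ n, a * b * c * r * (q : ℂ) ^ n] q (d * r))) ∧
    Summable (fun n : ℕ =>
      qShiftMul q [a * b, a * c, a * d, a * r] n * (b * c * d * r * z) ^ n /
        qShiftMul q [(q : ℂ), a ^ 2 * b * c * d * r * z, a * b * c * d, a * b * c * r] n *
      phi [a * b * (q : ℂ) ^ n, a * c * (q : ℂ) ^ n, b * c]
        [a * b * c * d * (q : ℂ) ^ n, a * b * c * r * (q : ℂ) ^ n] q (d * r)) ∧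
    Summable (vwpTerm (a ^ 2 * b * c * d * r / q)
      [a * b, a * c, a * d, a * r, 1 / z] q (b * c * d * r * z)) ∧
    ∑' n : ℕ,
      qShiftMul q [a * b, a * c, a * d, a * r] n * (b * c * d * r * z) ^ n /
        qShiftMul q [(q : ℂ), a ^ 2 * b * c * d * r * z, a * b * c * d, a * b * c * r] n *
      phi [a * b * (q : ℂ) ^ n, a * c * (q : ℂ) ^ n, b * c]
        [a * b * c * d * (q : ℂ) ^ n, a * b * c * r * (q : ℂ) ^ n] q (d * r) =
    qShiftInfMul q [a * b * d * r, a * c * d * r] /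
        qShiftInfMul q [d * r, a ^ 2 * b * c * d * r] *
      vwp (a ^ 2 * b * c * d * r / q)
        [a * b, a * c, a * d, a * r, 1 / z] q (b * c * d * r * z) := by
  have hq : ‖(q : ℂ)‖ < 1 := by rwa [Complex.norm_real, Real.norm_of_nonneg hq0.le]
  have hqne : (q : ℂ) ≠ 0 := Complex.ofReal_ne_zero.2 hq0.ne'
  generalize (q : ℂ) = q at *
  have hX : ‖b * c * d * r‖ < 1 :=
    norm_mul_lt_one (norm_mul_lt_one (norm_mul_lt_one hb hc) hd) hr
  have hP : ‖a ^ 2 * b * c * d * r‖ < 1 := by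
    rw [show a ^ 2 * b * c * d * r = a * (a * (b * c * d * r)) by ring]
    exact norm_mul_lt_one ha (norm_mul_lt_one ha hX)
  have hPz : ‖a ^ 2 * b * c * d * r * z‖ < 1 := by
    rw [show a ^ 2 * b * c * d * r * z = a * (a * (b * c * d * r * z)) by ring]
    exact norm_mul_lt_one ha (norm_mul_lt_one ha hconv)
  have hAP : a ^ 2 * b * c * d * r / q * q = a ^ 2 * b * c * d * r := div_mul_cancel₀ _ hqne
  have habc := norm_mul_lt_one (norm_mul_lt_one ha hb) hc
  have habcd := norm_mul_lt_one habc hd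
  have habcr := norm_mul_lt_one habc hr
  have habdr := norm_mul_lt_one (norm_mul_lt_one (norm_mul_lt_one ha hb) hd) hr
  have hacdr := norm_mul_lt_one (norm_mul_lt_one (norm_mul_lt_one ha hc) hd) hr
  -- Only k = 0 needs `hpole`; for larger k, A q^{2k} = P q^{2k-1} has norm below 1.
  have hA : ∀ k, 1 - a ^ 2 * b * c * d * r / q * q ^ (2 * k) ≠ 0 := by
    intro k
    rcases k with - | k
    · rw [mul_zero, pow_zero, mul_one, sub_ne_zero, ne_eq, eq_comm, div_eq_one_iff_eq hqne]
      exact hpole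
    · rw [show 2 * (k + 1) = 2 * k + 1 + 1 by ring, pow_succ' q, ← mul_assoc, hAP]
      exact one_sub_mul_pow_ne_zero hq hP _
  have hA0 : 1 - a ^ 2 * b * c * d * r / q ≠ 0 := by simpa using hA 0
  have hL : ∀ n, qShiftMul q [a * b, a * c, a * d, a * r] n * (b * c * d * r * z) ^ n /
        qShiftMul q [q, a ^ 2 * b * c * d * r * z, a * b * c * d, a * b * c * r] n *
      phi [a * b * q ^ n, a * c * q ^ n, b * c]
        [a * b * c * d * q ^ n, a * b * c * r * q ^ n] q (d * r) =
      qShift q (a * d) n * qShift q (a * r) n * (b * c * d * r * z) ^ n /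
        (qShift q q n * qShift q (a ^ 2 * b * c * d * r * z) n) * innerSum q a b c d r n := by
    intro n
    rw [← mul_phi_eq_innerSum]
    simp only [qShiftMul, List.map_cons, List.map_nil, List.prod_cons, List.prod_nil,
      div_eq_mul_inv, mul_inv]
    ring
  simp only [hL]
  refine ⟨fun n => summable_phiTerm_three_two hq (norm_mul_pow_lt_one hq habcd n)
    (norm_mul_pow_lt_one hq habcr n) (norm_mul_lt_one hd hr), ?_, ?_, ?_⟩
  · refine summable_of_isBigO_geometric hconv ((((((((isBigO_pow_top _).mul_one_top
      (isBigO_qShift hq (a * d) id)).mul_one_top (isBigO_qShift hq (a * r) id)).mul_one_top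
      (isBigO_inv_qShift_of_norm_lt hq hq id)).mul_one_top
      (isBigO_inv_qShift_of_norm_lt hq hPz id)).mul_one_top
      (isBigO_innerSum hq ha hb hc hd hr id)).congr_left fun n => ?_))
    simp only [id, div_eq_mul_inv, mul_inv]
    ring
  · refine summable_of_isBigO_geometric hconv ((((((((((((isBigO_pow_top _).mul_one_top
      (isBigO_vwpFactor (A := a ^ 2 * b * c * d * r / q) (z := z) hq (by rwa [hAP]) id)).mul_one_top
      (isBigO_qShift hq (a * b) id)).mul_one_top (isBigO_qShift hq (a * c) id)).mul_one_top
      (isBigO_qShift hq (a * d) id)).mul_one_top (isBigO_qShift hq (a * r) id)).mul_one_top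
      (isBigO_inv_qShift_of_norm_lt hq habcd id)).mul_one_top
      (isBigO_inv_qShift_of_norm_lt hq habcr id)).mul_one_top
      (isBigO_inv_qShift_of_norm_lt hq habdr id)).mul_one_top
      (isBigO_inv_qShift_of_norm_lt hq hacdr id)).congr_left fun n => ?_))
    rw [vwpTerm_eq hqne hA]
    simp only [id, div_eq_mul_inv, mul_inv]
    ring
  · set f : ℕ → ℕ → ℂ := fun k l =>
      qShift q (a * d) (k + l) * qShift q (a * r) (k + l) * (b * c * d * r) ^ (k + l) *
        invTerm q (a ^ 2 * b * c * d * r / q) z k l * innerSum q a b c d r (k + l) with hf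
    -- The factor z^k of `invTerm` joins (bcdr)^k, giving geometric decay of ratio bcdrz in k and
    -- bcdr in l; this covers |z| > 1.
    have hsum : Summable fun p : ℕ × ℕ => f p.1 p.2 := by
      refine summable_of_isBigO_geometric_prod hconv hX
        ((((((((isBigO_pow_mul_pow_top _ _).mul_one_top
          (isBigO_vwpFactor (A := a ^ 2 * b * c * d * r / q) (z := z) hq (by rwa [hAP])
            Prod.fst)).mul_one_top
          (isBigO_qShift hq (a * d) fun p => p.1 + p.2)).mul_one_top
          (isBigO_qShift hq (a * r) fun p => p.1 + p.2)).mul_one_top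
          (isBigO_inv_qShift_of_norm_lt hq hq Prod.snd)).mul_one_top
          (isBigO_inv_qShift_of_norm_lt hq hP fun p => 2 * p.1 + p.2)).mul_one_top
          (isBigO_innerSum hq ha hb hc hd hr fun p => p.1 + p.2)).congr_left fun p => ?_)
      simp only [hf, invTerm_eq_vwpFactor, hAP, mul_pow, pow_add]
      ring
    have hfin : ∀ n, qShift q (a * d) n * qShift q (a * r) n * (b * c * d * r * z) ^ n /
        (qShift q q n * qShift q (a ^ 2 * b * c * d * r * z) n) * innerSum q a b c d r n =
        ∑ k ∈ Finset.range (n + 1), f k (n - k) := by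
      intro n
      have h3 : ∀ k ∈ Finset.range (n + 1), f k (n - k) =
          qShift q (a * d) n * qShift q (a * r) n * (b * c * d * r) ^ n * innerSum q a b c d r n *
          invTerm q (a ^ 2 * b * c * d * r / q) z k (n - k) := by
        intro k hk
        simp only [hf, Nat.add_sub_cancel' (Nat.lt_succ_iff.1 (Finset.mem_range.1 hk))]
        ring
      rw [Finset.sum_congr rfl h3, ← Finset.mul_sum,
        sum_invTerm hz (qShift_ne_zero_of_norm_lt hq hq) hA0
          (by rw [hAP]; exact qShift_ne_zero_of_norm_lt hq hP)
          (by rw [hAP]; exact qShift_ne_zero_of_norm_lt hq hPz), hAP, mul_pow _ z]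
      ring
    rw [tsum_congr hfin, tsum_sum_range_eq_tsum_tsum hsum,
      tsum_congr fun k => tsum_vwpFactor_mul_innerSum hqne hq ha hb hc hd hr k, tsum_mul_left]
    congr 1
    · simp [qShiftInfMul]
    · exact tsum_congr fun k => (vwpTerm_eq hqne hA k).symm
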